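/- **Setting.** A team of $n$ quadcopters has states $\mathbf p_i=(x_i,y_i,z_i,\lambda_i)\in\mathbb R^4$ (position and focal length), $\mathbf p=(\mathbf p_1,\dots,\mathbf p_n)$. Let $r>0$, $R_i=rz_i/\lambda_i$, and let $I=(x_i,y_i)\in\mathbb R^2$ be the centre of quadcopter $i$ (likewise $J$, $K$ for $j$, $k$). The field of view is $\mathcal F_i=\{q\in\mathbb R^2:\|q-I\|\le R_i\}$, the power distance is $d_{\mathcal P}(\mathbf p_i,q)=\|q-I\|^2-R_i^2$, the power cell of $i$ is $\{q: d_{\mathcal P}(\mathbf p_i,q)\le d_{\mathcal P}(\mathbf p_j,q)\ \forall j\}$, and the communication graph has an edge between $i\ne j$ if $\mathcal F_i\cap\mathcal F_j\neq\emptyset$ and the power cells of $i$ and $j$ meet. A trio $\{i,j,k\}$ is *regular* at $\mathbf p$ if its centres are distinct and no two of the radical axes $L_{ij},L_{jk},L_{ki}$ ($L_{ij}=\{q:d_{\mathcal P}(\mathbf p_i,q)=d_{\mathcal P}(\mathbf p_j,q)\}$) are parallel or equal; then $v_{ijk}$ denotes the radical center, the only point with the same power distance to $i$, $j$ and $k$.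 For $\Delta=\{i,j,k\}$ let $$h_{IJK}=\frac{\mathbf e_z^\top(\overrightarrow{IJ}\times\overrightarrow{Iv_{ijk}})}{\mathbf e_z^\top(\overrightarrow{IJ}\times\overrightarrow{IK})},\qquad h_{i,\Delta,\mathcal F}=R_i^2-\|v_{ijk}-I\|^2,$$ define $h_{JKI},h_{KIJ}$ by cyclic permutation, let $h_{i,\Delta,1},\dots,h_{i,\Delta,4}$ be $-h_{IJK},-h_{JKI},-h_{KIJ},h_{i,\Delta,\mathcal F}$, and put $h_{i,\Delta}=\max_\ell h_{i,\Delta,\ell}$ and $I_{\epsilon,\Delta}(\mathbf p)=\{\ell:|h_{i,\Delta,\ell}(\mathbf p)-h_{i,\Delta}(\mathbf p)|<\epsilon\}$, where $\epsilon>0$. Every quadcopter $i$ has a switching sequence $t_0=\tau_i^1<\tau_i^2<\cdots\to\infty$. For each $t$ let $\mathcal T(t)$ be a set of trios, and let $\mathcal T_i(t)$ be the set of its members containing $i$; suppose that $\mathcal T_i(t)=\mathcal T_i(\tau_i^{\mathrm k})$ for $t\in[\tau_i^{\mathrm k},\tau_i^{\mathrm k+1})$. On this interval put $h_i(\mathbf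 p,t)=\min_{\Delta\in\mathcal T_i(\tau_i^{\mathrm k})}h_{i,\Delta}(\mathbf p)$ ($+\infty$ if there is no $\Delta$), and let $\mathcal C_i=\{(\mathbf p,t):t\ge t_0,\ h_i(\mathbf p,t)\ge0\}$. For all $i$ and $\mathrm k$ let the domain $\mathcal D_i^{\mathrm k}$ be an open set of states in which all $z_m,\lambda_m$ are positive and all $\Delta\in\mathcal T_i(\tau_i^{\mathrm k})$ are regular. Let $u_i(\mathbf p,t)\in\mathbb R^4$, $i=1,\dots,n$, be controllers, each measurable and locally bounded in $(\mathbf p,t)$, and $u=(u_1,\dots,u_n)$. A *trajectory* of the team on $[t_0,t_1]$ is an absolutely continuous $\mathbf p(\cdot)$ with $\dot{\mathbf p}(t)\in K[u](\mathbf p(t),t)$ for almost every $t$, $K$ being Filippov's operator, such that every member of $\mathcal T(t)$ is a triangular subgraph (3-clique) of the communication graph at $\mathbf p(t)$, for all $t\in[t_0,t_1]$, and $\mathbf p(t)\in\mathcal D_i^{\mathrm k}$ for all $i$, $\mathrm k$ and $t\in[t_0,t_1]\cap[\tau_i^{\mathrm k},\tau_i^{\mathrm k+1})$. Let the mission space $\mathcal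 Q\subset\mathbb R^2$ be compact and convex. A *hole* of $\{i,j,k\}$ is a closed set $E\subset\mathcal Q$ with nonempty interior such that $\mathrm{bd}(E)\cap\mathrm{bd}(\mathcal Q)=\emptyset$, $\mathrm{Int}(E)\cap\mathcal F_m=\emptyset$ for every quadcopter $m$, and $E\subset\triangle IJK$. **Theorem.** Let $\alpha:\mathbb R\to\mathbb R$ be a locally Lipschitz extended class-$\mathcal K$ function (strictly increasing, $\alpha(0)=0$). Suppose that for all $i$ and $\mathrm k$, all $t\in[\tau_i^{\mathrm k},\tau_i^{\mathrm k+1})$ and all $\mathbf p\in\mathcal D_i^{\mathrm k}$, $$\frac{\partial h_{i,\Delta,\ell}(\mathbf p)}{\partial\mathbf p_i}^{\!\top}u_i(\mathbf p,t)\ \ge\ -\tfrac13\,\alpha\big(h_{i,\Delta}(\mathbf p)\big)\qquad\forall\,\ell\in I_{\epsilon,\Delta}(\mathbf p),\ \forall\,\Delta\in\mathcal T_i(\tau_i^{\mathrm k}).$$ Then the following holds for every quadcopter $i$. 1. $\mathcal C_i$ is hybrid forward invariant: for every trajectory on an interval $[t_0,t_1]$, if $(\mathbf p(\tau_i^{\mathrm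 k}),\tau_i^{\mathrm k})\in\mathcal C_i$ for every switching instant $\tau_i^{\mathrm k}\le t_1$, then $(\mathbf p(t),t)\in\mathcal C_i$ for all $t\in[t_0,t_1]$. 2. For every trajectory on $[t_0,t_1]$: if at every switching instant $\tau_i^{\mathrm k}\le t_1$ each trio $\Delta\in\mathcal T_i(\tau_i^{\mathrm k})$ has its three centres in $\mathcal Q$, is a triangle of the Delaunay triangulation dual to the power diagram (its three power cells have a common point), and has no hole, then $(\mathbf p(t),t)\in\mathcal C_i$ for all $t\in[t_0,t_1]$. -/

import Mathlib

open Set Filter Topology MeasureTheory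

noncomputable section

namespace Coverage

/-! ### Differential inclusions, switching sequences, hybrid forward invariance -/

/-- Filippov's operator `K[U](x, t) = co {lim U(xₘ, t) : xₘ → x, xₘ ∉ S_f ∪ S}`, where `S_f` is a
particular null set and `S` an arbitrary one.  For measurable locally bounded `U` the value does not
depend on `S` once the exceptional null set `S_f` is removed, so it is the intersection over all
null sets `S`. -/
def filippov {X : Type*} [NormedAddCommGroup X] [NormedSpace ℝ X] [MeasureSpace X]
    (U : X → ℝ → X) (x : X) (t : ℝ) : Set X :=
  ⋂ (S : Set X) (_ : volume S = 0),
    convexHull ℝ {v | ∃ s : ℕ → X, Tendsto s atTop (𝓝 x) ∧ (∀ m, s m ∉ S) ∧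
      Tendsto (fun m => U (s m) t) atTop (𝓝 v)}

/-- `x` is a Carathéodory solution on `[t₀, t₁]` of the inclusion `x' ∈ K[U](x, t)`. -/
structure IsCaratheodorySolution {X : Type*} [NormedAddCommGroup X] [NormedSpace ℝ X]
    [MeasureSpace X] (U : X → ℝ → X) (t₀ t₁ : ℝ) (x : ℝ → X) : Prop where
  absolutelyContinuous : AbsolutelyContinuousOnInterval x t₀ t₁
  inclusion : ∀ᵐ t : ℝ, t ∈ Icc t₀ t₁ → ∃ v ∈ filippov U (x t) t, HasDerivAt x v t

/-- A switching sequence `τ⁰ = t₀ < τ¹ < τ² < ⋯ → ∞` (indexed from `0`). -/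
structure IsSwitchingSequence (t₀ : ℝ) (τ : ℕ → ℝ) : Prop where
  start : τ 0 = t₀
  strictMono : StrictMono τ
  unbounded : Tendsto τ atTop atTop

/-- The number of switching intervals needed to cover `[t₀, t₁]`. -/
def numIntervals (τ : ℕ → ℝ) (t₀ t₁ : ℝ) : ℕ :=
  sInf {K : ℕ | Icc t₀ t₁ ⊆ ⋃ k ∈ Finset.range K, Ico (τ k) (τ (k + 1))}

/-- Hybrid forward invariance of `C` for the trajectories `x` on `[t₀, t₁]` with
`IsTrajectory t₁ x`: if the trajectory is in `C` at all switching instants up to `t₁`, then it is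
in `C` on all of `[t₀, t₁]`. -/
def IsHybridForwardInvariant {X : Type*} (C : Set (X × ℝ)) (t₀ : ℝ) (τ : ℕ → ℝ)
    (IsTrajectory : ℝ → (ℝ → X) → Prop) : Prop :=
  ∀ (t₁ : ℝ) (x : ℝ → X), t₀ ≤ t₁ → IsTrajectory t₁ x →
    (∀ k < numIntervals τ t₀ t₁, (x (τ k), τ k) ∈ C) → ∀ t ∈ Icc t₀ t₁, (x t, t) ∈ C

/-- Locally Lipschitz extended class-`𝒦` functions. -/
structure IsExtendedClassK (α : ℝ → ℝ) : Prop where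
  locallyLipschitz : LocallyLipschitz α
  strictMono : StrictMono α
  zero : α 0 = 0

/-- Measurable and locally bounded (in state and time) feedback. -/
structure IsAdmissibleControl {X Y : Type*} [TopologicalSpace X] [MeasurableSpace X]
    [NormedAddCommGroup Y] [MeasurableSpace Y] (u : X → ℝ → Y) : Prop where
  measurable : Measurable fun w : X × ℝ => u w.1 w.2
  locallyBounded : ∀ w : X × ℝ, ∃ M : ℝ, ∀ᶠ w' in 𝓝 w, ‖u w'.1 w'.2‖ ≤ M

/-! ### Quadcopters, fields of view, power diagram -/

/-- The environment, the plane `{q | e_z · q = 0}`, in its coordinates `(q_x, q_y)`. -/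
abbrev Plane := EuclideanSpace ℝ (Fin 2)

/-- The state `(x, y, z, λ)` of one quadcopter: position and focal length. -/
abbrev AgentState := EuclideanSpace ℝ (Fin 4)

/-- The state of the team. -/
abbrev TeamState (n : ℕ) := Fin n → AgentState

variable {n : ℕ}

/-- The horizontal position of quadcopter `i`, i.e. the point `I` of the environment below it. -/
def center (p : TeamState n) (i : Fin n) : Plane := !₂[p i 0, p i 1]

/-- The radius `r z_i / λ_i` of the field of view (`r` is the radius of the image planes). -/
def radius (r : ℝ) (p : TeamState n) (i : Fin n) : ℝ := r * (p i 2 / p i 3)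

/-- The field of view of quadcopter `i`. -/
def fov (r : ℝ) (p : TeamState n) (i : Fin n) : Set Plane :=
  {q | ‖q - center p i‖ ≤ radius r p i}

/-- The power distance of the point `q` to quadcopter `i`. -/
def powerDist (r : ℝ) (p : TeamState n) (i : Fin n) (q : Plane) : ℝ :=
  ‖q - center p i‖ ^ 2 - radius r p i ^ 2

/-- The cell of quadcopter `i` in the power diagram. -/
def powerCell (r : ℝ) (p : TeamState n) (i : Fin n) : Set Plane :=
  {q | ∀ j, powerDist r p i q ≤ powerDist r p j q}

/-- The graph with an edge between quadcopters whose fields of view overlap. -/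
def fovGraph (r : ℝ) (p : TeamState n) : SimpleGraph (Fin n) where
  Adj i j := i ≠ j ∧ (fov r p i ∩ fov r p j).Nonempty
  symm := ⟨fun _ _ h => ⟨h.1.symm, by rw [inter_comm]; exact h.2⟩⟩
  loopless := ⟨fun _ h => h.1 rfl⟩

/-- The graph with an edge between quadcopters whose cells in the power diagram are adjacent. -/
def powerGraph (r : ℝ) (p : TeamState n) : SimpleGraph (Fin n) where
  Adj i j := i ≠ j ∧ (powerCell r p i ∩ powerCell r p j).Nonempty
  symm := ⟨fun _ _ h => ⟨h.1.symm, by rw [inter_comm]; exact h.2⟩⟩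
  loopless := ⟨fun _ h => h.1 rfl⟩

/-- The communication graph. -/
def commGraph (r : ℝ) (p : TeamState n) : SimpleGraph (Fin n) := fovGraph r p ⊓ powerGraph r p

/-- `i`, `j`, `k` form a triangle of the Delaunay triangulation dual to the power diagram: their
three cells meet in a vertex of the diagram. -/
def IsDelaunayTriangle (r : ℝ) (p : TeamState n) (i j k : Fin n) : Prop :=
  (powerCell r p i ∩ powerCell r p j ∩ powerCell r p k).Nonempty

/-- The third component of the cross product of two vectors of the plane. -/
def cross (a b : Plane) : ℝ := a 0 * b 1 - a 1 * b 0

/-- The radical axes `L_ij` and `L_kl` are parallel or equal.  The radical axis `L_ij` is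
perpendicular to `J - I`, so this says that these two normal vectors are linearly dependent. -/
def AxesParallel (p : TeamState n) (i j k l : Fin n) : Prop :=
  cross (center p j - center p i) (center p l - center p k) = 0

/-- No two of the three fields of view are concentric, and no two of the radical axes `L_ij`,
`L_jk`, `L_ki` are parallel. -/
structure IsNonParallel (p : TeamState n) (i j k : Fin n) : Prop where
  not_concentric_ij : center p i ≠ center p j
  not_concentric_jk : center p j ≠ center p k
  not_concentric_ki : center p k ≠ center p i
  not_parallel_ij_jk : ¬ AxesParallel p i j j k
  not_parallel_jk_ki : ¬ AxesParallel p j k k i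
  not_parallel_ki_ij : ¬ AxesParallel p k i i j

/-- The radical center `v_ijk`: the point with the same power distance to `i`, `j` and `k`,
written out with Cramer's rule (see `radicalCenter_unique`). -/
def radicalCenter (r : ℝ) (p : TeamState n) (i j k : Fin n) : Plane :=
  let a := center p j - center p i
  let b := center p k - center p i
  let c := fun m => ‖center p m‖ ^ 2 - radius r p m ^ 2
  !₂[((c j - c i) * b 1 - (c k - c i) * a 1) / (2 * cross a b),
     (a 0 * (c k - c i) - b 0 * (c j - c i)) / (2 * cross a b)]

/-- The radical center is the only point of equal power distance to the three quadcopters. -/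
theorem radicalCenter_unique (r : ℝ) (p : TeamState n) (i j k : Fin n)
    (h : IsNonParallel p i j k) (q : Plane) :
    q = radicalCenter r p i j k ↔
      powerDist r p i q = powerDist r p j q ∧ powerDist r p i q = powerDist r p k q := by
  have hc : cross (center p j - center p i) (center p k - center p i) ≠ 0 := by
    have h1 := h.not_parallel_ij_jk
    intro h2
    apply h1
    simp only [AxesParallel, cross, PiLp.sub_apply] at h2 ⊢
    linarith
  have hq : q = radicalCenter r p i j k ↔
      q 0 = radicalCenter r p i j k 0 ∧ q 1 = radicalCenter r p i j k 1 := by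
    constructor
    · rintro rfl
      exact ⟨rfl, rfl⟩
    · rintro ⟨h0, h1⟩
      ext m
      fin_cases m
      · exact h0
      · exact h1
  rw [hq]
  simp only [radicalCenter, powerDist, EuclideanSpace.norm_sq_eq, Fin.sum_univ_two,
    PiLp.toLp_apply, Matrix.cons_val_zero, Matrix.cons_val_one, Real.norm_eq_abs, sq_abs,
    PiLp.sub_apply]
  have hd : (2 : ℝ) * cross (center p j - center p i) (center p k - center p i) ≠ 0 :=
    mul_ne_zero two_ne_zero hc
  rw [eq_div_iff hd, eq_div_iff hd]
  simp only [cross, PiLp.sub_apply] at hc ⊢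
  constructor
  · rintro ⟨h0, h1⟩
    constructor
    · apply mul_left_cancel₀ hc
      linear_combination ((center p j 0) - (center p i 0)) * h0
        + ((center p j 1) - (center p i 1)) * h1
    · apply mul_left_cancel₀ hc
      linear_combination ((center p k 0) - (center p i 0)) * h0
        + ((center p k 1) - (center p i 1)) * h1
  · rintro ⟨h0, h1⟩
    constructor
    · linear_combination ((center p k 1) - (center p i 1)) * h0
        - ((center p j 1) - (center p i 1)) * h1
    · linear_combination ((center p j 0) - (center p i 0)) * h1
        - ((center p k 0) - (center p i 0)) * h0

/-- `E` is a hole of the trio `i`, `j`, `k` in the mission space `Q`: a closed subset of `Q` with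
nonempty interior, whose boundary does not meet that of `Q`, whose interior is not seen by any
quadcopter of the team, and which lies in the triangle `IJK`. -/
structure IsHole (r : ℝ) (Q : Set Plane) (p : TeamState n) (i j k : Fin n) (E : Set Plane) :
    Prop where
  isClosed : IsClosed E
  subset : E ⊆ Q
  interior_nonempty : (interior E).Nonempty
  frontier_disjoint : frontier E ∩ frontier Q = ∅
  unmonitored : ∀ m, interior E ∩ fov r p m = ∅
  subset_triangle : E ⊆ convexHull ℝ {center p i, center p j, center p k}

/-! ### The barrier functions -/

/-- `e_z · (IJ × Iv) / e_z · (IJ × IK)`; it is positive iff `v` and `K` are on the same side of the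
line `IJ`. -/
def sideFunction (I J K v : Plane) : ℝ := cross (J - I) (v - I) / cross (J - I) (K - I)

/-- The components `h_{i,Δ,ℓ}`, `Δ = {i, j, k}`: `-h_IJK`, `-h_JKI`, `-h_KIJ` and `h_F`. -/
def hComp (r : ℝ) (i j k : Fin n) (ℓ : Fin 4) (p : TeamState n) : ℝ :=
  let I := center p i
  let J := center p j
  let K := center p k
  let v := radicalCenter r p i j k
  ![-sideFunction I J K v, -sideFunction J K I v, -sideFunction K I J v,
    radius r p i ^ 2 - ‖v - I‖ ^ 2] ℓ

/-- `h_{i,Δ} = max_ℓ h_{i,Δ,ℓ}`, `Δ = {i, j, k}`. -/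
def hTrio (r : ℝ) (i j k : Fin n) (p : TeamState n) : ℝ :=
  Finset.univ.sup' ⟨0, Finset.mem_univ _⟩ fun ℓ : Fin 4 => hComp r i j k ℓ p

/-- The almost-active set of indices. -/
def almostActive (r ε : ℝ) (i j k : Fin n) (p : TeamState n) : Set (Fin 4) :=
  {ℓ | |hComp r i j k ℓ p - hTrio r i j k p| < ε}

/-- `h_i`, the minimum of `h_{i,Δ}` over the members `Δ` of `T` that contain `i`
(`⊤` if there are none). -/
def hAgent (r : ℝ) (T : Finset (Finset (Fin n))) (i : Fin n) (p : TeamState n) : EReal :=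
  ⨅ (j : Fin n) (k : Fin n) (_ : {i, j, k} ∈ T), (hTrio r i j k p : EReal)

/-- The safe set `C_i = {(p, t) | t ≥ t₀, h_i(p, t) ≥ 0}`, where on the `κ`-th switching interval of
quadcopter `i` the function `h_i` is formed with the triangular subgraphs present at its start. -/
def safeSet (r : ℝ) (T : ℝ → Finset (Finset (Fin n))) (τ : ℕ → ℝ) (i : Fin n) :
    Set (TeamState n × ℝ) :=
  {w | ∃ κ, w.2 ∈ Ico (τ κ) (τ (κ + 1)) ∧ 0 ≤ hAgent r (T (τ κ)) i w.1}

/-- The derivative `(∂f/∂p_i)ᵀ v` of `f` with respect to the state of quadcopter `i`. -/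
def partialDeriv (f : TeamState n → ℝ) (i : Fin n) (p : TeamState n) (v : AgentState) : ℝ :=
  fderiv ℝ (fun q : AgentState => f (Function.update p i q)) (p i) v

/-- The local constraint on the input `v` of quadcopter `i` at the state `p`. -/
def LocalConstraint (r ε : ℝ) (α : ℝ → ℝ) (T : Finset (Finset (Fin n))) (i : Fin n)
    (p : TeamState n) (v : AgentState) : Prop :=
  ∀ j k : Fin n, {i, j, k} ∈ T → ∀ ℓ ∈ almostActive r ε i j k p,
    -(1 / 3 : ℝ) * α (hTrio r i j k p) ≤ partialDeriv (hComp r i j k ℓ) i p v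

/-- The states at which `h_i` (formed with `T`) is smoothly composed: positive heights and focal
lengths, and no concentric fields of view or parallel radical axes in a trio of `T` with `i`. -/
def regularStates (T : Finset (Finset (Fin n))) (i : Fin n) : Set (TeamState n) :=
  {p | (∀ m, 0 < p m 2 ∧ 0 < p m 3) ∧ ∀ j k : Fin n, {i, j, k} ∈ T → IsNonParallel p i j k}

/-- The trajectories of the team under the controllers `u`: Carathéodory solutions of the
closed loop for which the members of `T t` are triangular subgraphs of the communication graph at
time `t`, and which on the `κ`-th switching interval of quadcopter `i` stay in the domain `D i κ`
of its barrier function. -/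
structure IsTeamTrajectory (r : ℝ) (T : ℝ → Finset (Finset (Fin n))) (τ : Fin n → ℕ → ℝ)
    (D : Fin n → ℕ → Set (TeamState n)) (u : Fin n → TeamState n → ℝ → AgentState)
    (t₀ t₁ : ℝ) (x : ℝ → TeamState n) : Prop where
  solution : IsCaratheodorySolution (fun p t i => u i p t) t₀ t₁ x
  triangular : ∀ t ∈ Icc t₀ t₁, ∀ Δ ∈ T t, (commGraph r (x t)).IsNClique 3 Δ
  mem_domain : ∀ i κ, ∀ t ∈ Icc t₀ t₁, t ∈ Ico (τ i κ) (τ i (κ + 1)) → x t ∈ D i κ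

/-- The trio `i`, `j`, `k` is located above the mission space `Q`. -/
def TrioAbove (Q : Set Plane) (p : TeamState n) (i j k : Fin n) : Prop :=
  center p i ∈ Q ∧ center p j ∈ Q ∧ center p k ∈ Q

end Coverage

end

/-!
The barrier function `h_{i,Δ}` of a trio `Δ = {i, j, k}` does not depend on which member evaluates
it.  The three side functions are the barycentric coordinates of the radical center in the triangle
`IJK`, and the last component is minus the common power distance of the radical center to the three
quadcopters, so a cyclic relabelling of the trio only permutes the components (`hComp_rotate`).
Since the components depend on the states of `i`, `j`, `k` alone, the constraints of the three
members, each contributing `-α(h) / 3`, add up to `-α(h)` as a lower bound for the derivative of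
every almost active component along the closed loop (`neg_le_fderiv_hComp`).  The bound is
an affine inequality in the velocity with coefficients continuous in the state, so it survives
Filippov's convexification (`le_of_mem_filippov`).

The maximum `h` of the components is then invariantly nonnegative (`sup'_nonneg_of_barrier`): if it
were negative at some time, take the last earlier time `s` at which it is nonnegative and a
component active at `s`.  Just after `s` this component is still almost active and `-α(h) ≥ 0`, so
it is an absolutely continuous function with nonnegative derivative almost everywhere, it stays
nonnegative, and so does `h`.  This settles each switching interval (`hAgent_nonneg_of_mem_Ico`),
and the first part of the theorem follows because the state is in the safe set at the beginning of
every such interval.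

For the second part it remains to see that `h ≥ 0` at the switching instants.  If `h < 0`, the
radical center lies in the open triangle `IJK` and has positive power distance to `i`.  By the
Delaunay property it belongs to the power cell of `i`, so its power distance to all quadcopters is
positive, and a small closed disk about it is a hole (`exists_isHole`).
-/

/-! ### Absolutely continuous functions -/

theorem AbsolutelyContinuousOnInterval.comp_lipschitzOnWith {X Y : Type*} [PseudoMetricSpace X]
    [PseudoMetricSpace Y] {f : ℝ → X} {g : X → Y} {K : NNReal} {s : Set X} {a b : ℝ}
    (hf : AbsolutelyContinuousOnInterval f a b) (hg : LipschitzOnWith K g s)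
    (hfs : MapsTo f (uIcc a b) s) : AbsolutelyContinuousOnInterval (fun t => g (f t)) a b := by
  rw [absolutelyContinuousOnInterval_iff] at hf ⊢
  intro ε hε
  have hK : (0 : ℝ) < K + 1 := by positivity
  obtain ⟨δ, hδ, h⟩ := hf (ε / (K + 1)) (by positivity)
  refine ⟨δ, hδ, fun E hE hlen => ?_⟩
  have hE' := h E hE hlen
  rw [lt_div_iff₀ hK] at hE'
  refine lt_of_le_of_lt ?_ hE'
  rw [Finset.sum_mul]
  refine Finset.sum_le_sum fun m hm => ?_
  have hmem := hE.1 m hm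
  refine (hg.dist_le_mul _ (hfs hmem.1) _ (hfs hmem.2)).trans ?_
  nlinarith [dist_nonneg (x := f (E.2 m).1) (y := f (E.2 m).2)]

theorem AbsolutelyContinuousOnInterval.le_of_ae_deriv_nonneg {f : ℝ → ℝ} {a b : ℝ} (hab : a ≤ b)
    (hf : AbsolutelyContinuousOnInterval f a b)
    (hd : ∀ᵐ t : ℝ, t ∈ Ioc a b → 0 ≤ deriv f t) : f a ≤ f b := by
  rw [← sub_nonneg, ← hf.integral_deriv_eq_sub, intervalIntegral.integral_of_le hab]
  exact setIntegral_nonneg_of_ae_restrict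
    ((ae_restrict_iff' measurableSet_Ioc).2 hd)

namespace Coverage

/-! ### Differential inclusions and switching sequences -/

/-- A linear inequality that holds for the values of `U` near `x` passes to Filippov's operator,
because the limits of these values lie in a closed half-space, which is convex. -/
theorem le_of_mem_filippov {X : Type*} [NormedAddCommGroup X] [NormedSpace ℝ X] [MeasureSpace X]
    {U : X → ℝ → X} {x v : X} {t : ℝ} {φ : X → X →L[ℝ] ℝ} {β : X → ℝ}
    (hv : v ∈ filippov U x t) (hφ : ContinuousAt φ x) (hβ : ContinuousAt β x)
    (h : ∀ᶠ q in 𝓝 x, β q ≤ φ q (U q t)) : β x ≤ φ x v := by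
  -- The bound holds at all states near `x`, so no exceptional null set has to be avoided.
  have hv' := mem_iInter₂.1 hv ∅ measure_empty
  have hconv : Convex ℝ {w : X | β x ≤ φ x w} :=
    convex_halfSpace_ge (φ x).toLinearMap.isLinear _
  refine convexHull_min ?_ hconv hv'
  rintro w ⟨s, hs, -, hw⟩
  exact le_of_tendsto_of_tendsto (hβ.tendsto.comp hs)
    ((isBoundedBilinearMap_apply.continuous.tendsto (φ x, w)).comp
      ((hφ.tendsto.comp hs).prodMk_nhds hw)) (hs.eventually h)

/-- If the almost active among finitely many `C¹` functions satisfy a barrier inequality along `x`,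
then their maximum cannot become negative.  After the last time `s` at which the maximum is
nonnegative, a function active at `s` remains almost active for a while and cannot decrease. -/
theorem sup'_nonneg_of_barrier {X ι : Type*} [NormedAddCommGroup X] [NormedSpace ℝ X]
    [Fintype ι] (hne : (Finset.univ : Finset ι).Nonempty) {h : ι → X → ℝ} {x : ℝ → X}
    {a b ε : ℝ} {α : ℝ → ℝ} (hab : a ≤ b) (hε : 0 < ε) (hα : ∀ y ≤ 0, α y ≤ 0)
    (hx : AbsolutelyContinuousOnInterval x a b)
    (hC : ∀ t ∈ Icc a b, ∀ l, ContDiffAt ℝ 1 (h l) (x t))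
    (hd : ∀ᵐ t : ℝ, t ∈ Icc a b → ∃ v, HasDerivAt x v t ∧ ∀ l,
      |h l (x t) - Finset.univ.sup' hne (fun l => h l (x t))| < ε →
        -α (Finset.univ.sup' hne fun l => h l (x t)) ≤ fderiv ℝ (h l) (x t) v)
    (ha : 0 ≤ Finset.univ.sup' hne fun l => h l (x a)) :
    0 ≤ Finset.univ.sup' hne fun l => h l (x b) := by
  set H : X → ℝ := fun p => Finset.univ.sup' hne fun l => h l p with hH
  have hxc : ContinuousOn x (Icc a b) := by
    have := hx.continuousOn
    rwa [uIcc_of_le hab] at this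
  have hlc : ∀ l, ContinuousOn (fun t => h l (x t)) (Icc a b) := fun l t ht =>
    (hC t ht l).continuousAt.comp_continuousWithinAt (hxc t ht)
  have hHc : ContinuousOn (fun t => H (x t)) (Icc a b) :=
    ContinuousOn.finset_sup'_apply hne fun l _ => hlc l
  by_contra! hb
  change H (x b) < 0 at hb
  change 0 ≤ H (x a) at ha
  have hcl : IsClosed (Icc a b ∩ (fun t => H (x t)) ⁻¹' Ici 0) :=
    hHc.preimage_isClosed_of_isClosed isClosed_Icc isClosed_Ici
  obtain ⟨s, ⟨hsI, hs0⟩, hsmax⟩ := (isCompact_Icc.of_isClosed_subset hcl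
    inter_subset_left).exists_isGreatest ⟨a, left_mem_Icc.2 hab, ha⟩
  change 0 ≤ H (x s) at hs0
  have hsb : s < b := lt_of_le_of_ne hsI.2 fun h => by subst h; linarith
  have hneg : ∀ t ∈ Ioc s b, H (x t) < 0 := fun t ht => by
    by_contra! h0
    exact (hsmax ⟨⟨hsI.1.trans ht.1.le, ht.2⟩, h0⟩).not_gt ht.1
  -- The index `l` is active at `s`, so it is almost active, and `h l` is Lipschitz, near `x s`.
  obtain ⟨l, -, hl⟩ := Finset.exists_mem_eq_sup' hne fun l => h l (x s)
  change H (x s) = h l (x s) at hl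
  obtain ⟨K, W, hW, hLip⟩ := (hC s hsI l).exists_lipschitzOnWith
  have hnear : ∀ᶠ t in 𝓝[Icc a b] s, x t ∈ W ∧ |h l (x t) - H (x t)| < ε := by
    refine ((hxc s hsI).eventually hW).and ?_
    refine ((((hlc l).sub hHc).abs) s hsI).eventually_lt_const ?_
    simpa [hl] using hε
  have hnear' : ∀ᶠ t in 𝓝[≥] s, x t ∈ W ∧ |h l (x t) - H (x t)| < ε := by
    rw [← nhdsWithin_Icc_eq_nhdsGE hsb]
    exact nhdsWithin_mono _ (Icc_subset_Icc_left hsI.1) hnear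
  obtain ⟨d, hsd, hdW⟩ := mem_nhdsGE_iff_exists_Icc_subset.1 hnear'
  obtain ⟨c, hc, hcW⟩ : ∃ c ∈ Ioc s b, ∀ t ∈ Icc s c,
      x t ∈ W ∧ |h l (x t) - H (x t)| < ε :=
    ⟨min d b, ⟨lt_min hsd hsb, min_le_right d b⟩, fun t ht =>
      hdW (Icc_subset_Icc_right (min_le_left d b) ht)⟩
  have hsub : Icc s c ⊆ Icc a b := Icc_subset_Icc hsI.1 hc.2
  have hac : AbsolutelyContinuousOnInterval (fun t => h l (x t)) s c := by
    refine (hx.mono ?_).comp_lipschitzOnWith hLip ?_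
    · rwa [uIcc_of_le hc.1.le, uIcc_of_le hab]
    · rw [uIcc_of_le hc.1.le]
      exact fun t ht => (hcW t ht).1
  have hle : h l (x s) ≤ h l (x c) := by
    refine hac.le_of_ae_deriv_nonneg hc.1.le ?_
    filter_upwards [hd] with t ht htc
    have htI := hsub (Ioc_subset_Icc_self htc)
    obtain ⟨v, hv, hbar⟩ := ht htI
    have hder : HasDerivAt (fun t => h l (x t)) (fderiv ℝ (h l) (x t) v) t :=
      ((hC t htI l).differentiableAt one_ne_zero).hasFDerivAt.comp_hasDerivAt t hv
    rw [hder.deriv]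
    have h1 := hbar l (hcW t (Ioc_subset_Icc_self htc)).2
    have h2 := hα _ (hneg t ⟨htc.1, htc.2.trans hc.2⟩).le
    simp only [hH] at h2
    linarith
  have h3 : h l (x c) ≤ H (x c) := Finset.le_sup' (fun l => h l (x c)) (Finset.mem_univ l)
  linarith [hneg c hc]

theorem IsSwitchingSequence.exists_mem_Ico {t₀ : ℝ} {τ : ℕ → ℝ} (h : IsSwitchingSequence t₀ τ)
    {t : ℝ} (ht : t₀ ≤ t) : ∃ κ, t ∈ Ico (τ κ) (τ (κ + 1)) := by
  classical
  have hex : ∃ m, t < τ m := (h.unbounded.eventually_gt_atTop t).exists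
  have hpos : Nat.find hex ≠ 0 := fun h0 => by
    have := Nat.find_spec hex
    rw [h0, h.start] at this
    linarith
  obtain ⟨κ, hκ⟩ := Nat.exists_eq_succ_of_ne_zero hpos
  refine ⟨κ, ?_, ?_⟩
  · exact not_lt.1 (Nat.find_min hex (by omega))
  · have := Nat.find_spec hex
    rwa [hκ] at this

theorem IsSwitchingSequence.exists_lt_numIntervals {t₀ : ℝ} {τ : ℕ → ℝ}
    (h : IsSwitchingSequence t₀ τ) {t t₁ : ℝ} (ht : t ∈ Icc t₀ t₁) :
    ∃ κ < numIntervals τ t₀ t₁, t ∈ Ico (τ κ) (τ (κ + 1)) := by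
  have hne : {K : ℕ | Icc t₀ t₁ ⊆ ⋃ k ∈ Finset.range K, Ico (τ k) (τ (k + 1))}.Nonempty := by
    obtain ⟨K, hK⟩ := (h.unbounded.eventually_gt_atTop t₁).exists
    refine ⟨K, fun s hs => ?_⟩
    obtain ⟨κ, hκ⟩ := h.exists_mem_Ico hs.1
    have : κ < K := h.strictMono.lt_iff_lt.1 (hκ.1.trans_lt (hs.2.trans_lt hK))
    exact mem_biUnion (Finset.mem_coe.2 (Finset.mem_range.2 this)) hκ
  have := Nat.sInf_mem hne ht
  change t ∈ ⋃ k ∈ Finset.range (numIntervals τ t₀ t₁), Ico (τ k) (τ (k + 1)) at this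
  simpa only [mem_iUnion, Finset.mem_range, exists_prop] using this

theorem IsSwitchingSequence.eq_of_mem_Ico {t₀ : ℝ} {τ : ℕ → ℝ} (h : IsSwitchingSequence t₀ τ)
    {t : ℝ} {κ κ' : ℕ} (hκ : t ∈ Ico (τ κ) (τ (κ + 1))) (hκ' : t ∈ Ico (τ κ') (τ (κ' + 1))) :
    κ = κ' := by
  have h1 := h.strictMono.lt_iff_lt.1 (hκ.1.trans_lt hκ'.2)
  have h2 := h.strictMono.lt_iff_lt.1 (hκ'.1.trans_lt hκ.2)
  omega

/-! ### Symmetry of the barrier functions in the trio -/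

theorem IsNonParallel.cross_ne_zero {n : ℕ} {p : TeamState n} {i j k : Fin n}
    (h : IsNonParallel p i j k) : cross (center p j - center p i) (center p k - center p i) ≠ 0 := by
  intro h2
  apply h.not_parallel_ij_jk
  simp only [AxesParallel, cross, PiLp.sub_apply] at h2 ⊢
  linarith

theorem IsNonParallel.rotate {n : ℕ} {p : TeamState n} {i j k : Fin n}
    (h : IsNonParallel p i j k) : IsNonParallel p j k i :=
  ⟨h.2, h.3, h.1, h.5, h.6, h.4⟩

theorem powerDist_radicalCenter {n : ℕ} (r : ℝ) {p : TeamState n} {i j k : Fin n}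
    (h : IsNonParallel p i j k) :
    powerDist r p i (radicalCenter r p i j k) = powerDist r p j (radicalCenter r p i j k) ∧
      powerDist r p i (radicalCenter r p i j k) = powerDist r p k (radicalCenter r p i j k) :=
  (radicalCenter_unique r p i j k h _).1 rfl

theorem radicalCenter_rotate {n : ℕ} (r : ℝ) {p : TeamState n} {i j k : Fin n}
    (h : IsNonParallel p i j k) : radicalCenter r p j k i = radicalCenter r p i j k := by
  obtain ⟨h1, h2⟩ := powerDist_radicalCenter r h
  exact ((radicalCenter_unique r p j k i h.rotate _).2 ⟨h1.symm.trans h2, h1.symm⟩).symm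

/-- The permutation of the components of `h_{i,Δ}` under the cyclic relabelling
`(i, j, k) ↦ (j, k, i)` of the trio. -/
def componentRotation : Equiv.Perm (Fin 4) := Equiv.swap 0 1 * Equiv.swap 1 2

theorem hComp_rotate {n : ℕ} (r : ℝ) {p : TeamState n} {i j k : Fin n}
    (h : IsNonParallel p i j k) (ℓ : Fin 4) :
    hComp r j k i ℓ p = hComp r i j k (componentRotation ℓ) p := by
  have e0 : componentRotation 0 = 1 := by decide
  have e1 : componentRotation 1 = 2 := by decide
  have e2 : componentRotation 2 = 0 := by decide
  have e3 : componentRotation 3 = 3 := by decide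
  have hp := (powerDist_radicalCenter r h).1
  simp only [powerDist] at hp
  fin_cases ℓ
  · simp [hComp, radicalCenter_rotate r h, e0]
  · simp [hComp, radicalCenter_rotate r h, e1]
  · simp [hComp, radicalCenter_rotate r h, e2]
  · simp [hComp, radicalCenter_rotate r h, e3]
    linarith

theorem hTrio_rotate {n : ℕ} (r : ℝ) {p : TeamState n} {i j k : Fin n}
    (h : IsNonParallel p i j k) : hTrio r j k i p = hTrio r i j k p := by
  apply le_antisymm
  · refine Finset.sup'_le _ _ fun ℓ _ => ?_
    rw [hComp_rotate r h]
    exact Finset.le_sup' (fun ℓ => hComp r i j k ℓ p) (Finset.mem_univ _)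
  · refine Finset.sup'_le _ _ fun ℓ _ => ?_
    have := hComp_rotate r h (componentRotation.symm ℓ)
    rw [Equiv.apply_symm_apply] at this
    rw [← this]
    exact Finset.le_sup' (fun ℓ => hComp r j k i ℓ p) (Finset.mem_univ _)

/-! ### Regularity and derivatives of the barrier functions -/

theorem contDiff_center {n : ℕ} (i : Fin n) :
    ContDiff ℝ 1 fun p : TeamState n => center p i := by
  rw [contDiff_euclidean]
  intro m
  fin_cases m <;> simp [center] <;> fun_prop

theorem contDiffAt_radius {n : ℕ} (r : ℝ) {p : TeamState n} {i : Fin n} (h : p i 3 ≠ 0) :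
    ContDiffAt ℝ 1 (fun p : TeamState n => radius r p i) p := by
  unfold radius
  exact contDiffAt_const.mul (ContDiffAt.div (by fun_prop) (by fun_prop) h)

theorem _root_.ContDiffAt.coverage_cross {X : Type*} [NormedAddCommGroup X] [NormedSpace ℝ X]
    {f g : X → Plane} {x : X} (hf : ContDiffAt ℝ 1 f x) (hg : ContDiffAt ℝ 1 g x) :
    ContDiffAt ℝ 1 (fun y => cross (f y) (g y)) x := by
  rw [contDiffAt_euclidean] at hf hg
  exact ((hf 0).mul (hg 1)).sub ((hf 1).mul (hg 0))

theorem contDiffAt_radicalCenter {n : ℕ} (r : ℝ) {p : TeamState n} {i j k : Fin n}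
    (hp : ∀ m, p m 3 ≠ 0) (h : IsNonParallel p i j k) :
    ContDiffAt ℝ 1 (fun p : TeamState n => radicalCenter r p i j k) p := by
  have hc : ∀ m, ContDiffAt ℝ 1 (fun p : TeamState n => center p m) p := fun m =>
    (contDiff_center m).contDiffAt
  have hcoord : ∀ m l, ContDiffAt ℝ 1 (fun p : TeamState n => center p m l) p := fun m l =>
    contDiffAt_euclidean.1 (hc m) l
  have hw : ∀ m, ContDiffAt ℝ 1 (fun p : TeamState n => ‖center p m‖ ^ 2 - radius r p m ^ 2) p :=
    fun m => ((hc m).norm_sq ℝ).sub ((contDiffAt_radius r (hp m)).pow 2)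
  have hden : ContDiffAt ℝ 1 (fun p : TeamState n =>
      2 * cross (center p j - center p i) (center p k - center p i)) p :=
    contDiffAt_const.mul (((hc j).sub (hc i)).coverage_cross ((hc k).sub (hc i)))
  have hden0 := mul_ne_zero two_ne_zero h.cross_ne_zero
  rw [contDiffAt_euclidean]
  intro m
  fin_cases m
  · exact ((((hw j).sub (hw i)).mul ((hcoord k 1).sub (hcoord i 1))).sub
      (((hw k).sub (hw i)).mul ((hcoord j 1).sub (hcoord i 1)))).div hden hden0
  · exact ((((hcoord j 0).sub (hcoord i 0)).mul ((hw k).sub (hw i))).sub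
      (((hcoord k 0).sub (hcoord i 0)).mul ((hw j).sub (hw i)))).div hden hden0

theorem contDiffAt_hComp {n : ℕ} (r : ℝ) {p : TeamState n} {i j k : Fin n}
    (hp : ∀ m, p m 3 ≠ 0) (h : IsNonParallel p i j k) (ℓ : Fin 4) :
    ContDiffAt ℝ 1 (hComp r i j k ℓ) p := by
  have hc : ∀ m, ContDiffAt ℝ 1 (fun p : TeamState n => center p m) p := fun m =>
    (contDiff_center m).contDiffAt
  have hv := contDiffAt_radicalCenter r hp h
  have hs : ∀ a b c : Fin n, IsNonParallel p a b c → ContDiffAt ℝ 1 (fun p : TeamState n =>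
      -sideFunction (center p a) (center p b) (center p c) (radicalCenter r p i j k)) p :=
    fun a b c habc => ((((hc b).sub (hc a)).coverage_cross (hv.sub (hc a))).div
      (((hc b).sub (hc a)).coverage_cross ((hc c).sub (hc a))) habc.cross_ne_zero).neg
  fin_cases ℓ
  · exact hs i j k h
  · exact hs j k i h.rotate
  · exact hs k i j h.rotate.rotate
  · exact ((contDiffAt_radius r (hp i)).pow 2).sub ((hv.sub (hc i)).norm_sq ℝ)

theorem continuousAt_hTrio {n : ℕ} (r : ℝ) {p : TeamState n} {i j k : Fin n}
    (hp : ∀ m, p m 3 ≠ 0) (h : IsNonParallel p i j k) : ContinuousAt (hTrio r i j k) p :=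
  ContinuousAt.finset_sup'_apply _ fun ℓ _ => (contDiffAt_hComp r hp h ℓ).continuousAt

theorem partialDeriv_eq_fderiv_single {n : ℕ} {f : TeamState n → ℝ} {p : TeamState n}
    (hf : DifferentiableAt ℝ f p) (i : Fin n) (v : AgentState) :
    partialDeriv f i p v = fderiv ℝ f p (Pi.single i v) := by
  have h1 : HasFDerivAt f (fderiv ℝ f p) (Function.update p i (p i)) := by
    rw [Function.update_eq_self]
    exact hf.hasFDerivAt
  have h2 := h1.comp (p i) (hasFDerivAt_update p (p i))
  have h3 := h2.fderiv
  unfold partialDeriv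
  rw [show (fun q : AgentState => f (Function.update p i q)) = f ∘ Function.update p i from rfl, h3]
  simp only [ContinuousLinearMap.comp_apply]
  congr 1
  ext m
  rcases eq_or_ne m i with rfl | hm
  · simp
  · simp [hm]

theorem hComp_congr {n : ℕ} (r : ℝ) {p q : TeamState n} {i j k : Fin n} (hi : p i = q i)
    (hj : p j = q j) (hk : p k = q k) (ℓ : Fin 4) : hComp r i j k ℓ p = hComp r i j k ℓ q := by
  simp only [hComp, radicalCenter, center, radius, hi, hj, hk]

/-- The component functions of a trio depend only on the states of its three members, so that
their derivative is the sum of three partial derivatives. -/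
theorem fderiv_hComp {n : ℕ} (r : ℝ) {p : TeamState n} {i j k : Fin n}
    (hp : ∀ m, p m 3 ≠ 0) (h : IsNonParallel p i j k) (ℓ : Fin 4) (v : TeamState n) :
    fderiv ℝ (hComp r i j k ℓ) p v = partialDeriv (hComp r i j k ℓ) i p (v i) +
      partialDeriv (hComp r i j k ℓ) j p (v j) + partialDeriv (hComp r i j k ℓ) k p (v k) := by
  have hd := (contDiffAt_hComp r hp h ℓ).differentiableAt one_ne_zero
  have hij : i ≠ j := fun e => h.1 (by rw [e])
  have hjk : j ≠ k := fun e => h.2 (by rw [e])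
  have hki : k ≠ i := fun e => h.3 (by rw [e])
  have hzero : ∀ m, m ∉ ({i, j, k} : Finset (Fin n)) →
      partialDeriv (hComp r i j k ℓ) m p (v m) = 0 := by
    intro m hm
    simp only [Finset.mem_insert, Finset.mem_singleton, not_or] at hm
    have : (fun q : AgentState => hComp r i j k ℓ (Function.update p m q)) =
        fun _ => hComp r i j k ℓ p := by
      funext q
      exact hComp_congr r (Function.update_of_ne (Ne.symm hm.1) _ _)
        (Function.update_of_ne (Ne.symm hm.2.1) _ _) (Function.update_of_ne (Ne.symm hm.2.2) _ _) ℓ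
    rw [partialDeriv, this]
    simp
  calc fderiv ℝ (hComp r i j k ℓ) p v
      = ∑ m, partialDeriv (hComp r i j k ℓ) m p (v m) := by
        simp_rw [partialDeriv_eq_fderiv_single hd, ← map_sum]
        rw [Finset.univ_sum_single]
    _ = ∑ m ∈ ({i, j, k} : Finset (Fin n)), partialDeriv (hComp r i j k ℓ) m p (v m) :=
        (Finset.sum_subset (Finset.subset_univ _) fun m _ hm => hzero m hm).symm
    _ = _ := by
        rw [Finset.sum_insert (by simp [hij, hki.symm]), Finset.sum_insert (by simp [hjk]),
          Finset.sum_singleton, add_assoc]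

theorem isOpen_isNonParallel {n : ℕ} (i j k : Fin n) :
    IsOpen {p : TeamState n | IsNonParallel p i j k} := by
  have hc : ∀ m, Continuous fun p : TeamState n => center p m := fun m =>
    (contDiff_center m).continuous
  have hx : ∀ a b c d : Fin n, Continuous fun p : TeamState n =>
      cross (center p b - center p a) (center p d - center p c) := fun a b c d =>
    contDiff_iff_contDiffAt.2 (fun p => ContDiffAt.coverage_cross
      ((contDiff_center b).sub (contDiff_center a)).contDiffAt
      ((contDiff_center d).sub (contDiff_center c)).contDiffAt) |>.continuous
  have : {p : TeamState n | IsNonParallel p i j k} =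
      {p | center p i ≠ center p j} ∩ {p | center p j ≠ center p k} ∩
      {p | center p k ≠ center p i} ∩ {p | ¬ AxesParallel p i j j k} ∩
      {p | ¬ AxesParallel p j k k i} ∩ {p | ¬ AxesParallel p k i i j} := by
    ext p
    exact ⟨fun h => ⟨⟨⟨⟨⟨h.1, h.2⟩, h.3⟩, h.4⟩, h.5⟩, h.6⟩,
      fun ⟨⟨⟨⟨⟨h1, h2⟩, h3⟩, h4⟩, h5⟩, h6⟩ => ⟨h1, h2, h3, h4, h5, h6⟩⟩
  rw [this]
  exact (((((isOpen_ne_fun (hc i) (hc j)).inter (isOpen_ne_fun (hc j) (hc k))).inter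
    (isOpen_ne_fun (hc k) (hc i))).inter (isOpen_ne_fun (hx i j j k) continuous_const)).inter
    (isOpen_ne_fun (hx j k k i) continuous_const)).inter
    (isOpen_ne_fun (hx k i i j) continuous_const)

theorem partialDeriv_hComp_rotate {n : ℕ} (r : ℝ) {p : TeamState n} {i j k : Fin n}
    (hp : ∀ m, p m 3 ≠ 0) (h : IsNonParallel p i j k) (ℓ : Fin 4) (m : Fin n) (v : AgentState) :
    partialDeriv (hComp r j k i ℓ) m p v =
      partialDeriv (hComp r i j k (componentRotation ℓ)) m p v := by
  have he : hComp r j k i ℓ =ᶠ[𝓝 p] hComp r i j k (componentRotation ℓ) := by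
    filter_upwards [(isOpen_isNonParallel i j k).mem_nhds h] with q hq
    exact hComp_rotate r hq ℓ
  rw [partialDeriv_eq_fderiv_single
      ((contDiffAt_hComp r hp h.rotate ℓ).differentiableAt one_ne_zero),
    partialDeriv_eq_fderiv_single ((contDiffAt_hComp r hp h _).differentiableAt one_ne_zero),
    he.fderiv_eq]

/-! ### The decentralized constraints -/

/-- A lower bound for the partial derivatives of the almost active components of `(j, k, i)` is one
for those of `(i, j, k)`, because these are the same functions in another order. -/
theorem le_partialDeriv_rotate {n : ℕ} (r ε : ℝ) (α : ℝ → ℝ) {p : TeamState n} {i j k : Fin n}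
    (hp : ∀ m, p m 3 ≠ 0) (h : IsNonParallel p i j k) {m : Fin n} {v : AgentState}
    (hc : ∀ ℓ ∈ almostActive r ε j k i p,
      -(1 / 3 : ℝ) * α (hTrio r j k i p) ≤ partialDeriv (hComp r j k i ℓ) m p v)
    {ℓ : Fin 4} (hℓ : ℓ ∈ almostActive r ε i j k p) :
    -(1 / 3 : ℝ) * α (hTrio r i j k p) ≤ partialDeriv (hComp r i j k ℓ) m p v := by
  obtain ⟨ℓ, rfl⟩ := componentRotation.surjective ℓ
  rw [← partialDeriv_hComp_rotate r hp h, ← hTrio_rotate r h]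
  refine hc ℓ ?_
  simpa only [almostActive, mem_ofPred_eq, hComp_rotate r h, hTrio_rotate r h] using hℓ

theorem neg_le_fderiv_hComp {n : ℕ} {r ε : ℝ} {α : ℝ → ℝ} {p v : TeamState n} {i j k : Fin n}
    {Ti Tj Tk : Finset (Finset (Fin n))} (hp : ∀ m, p m 3 ≠ 0) (h : IsNonParallel p i j k)
    (hTi : {i, j, k} ∈ Ti) (hTj : {i, j, k} ∈ Tj) (hTk : {i, j, k} ∈ Tk)
    (hi : LocalConstraint r ε α Ti i p (v i)) (hj : LocalConstraint r ε α Tj j p (v j))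
    (hk : LocalConstraint r ε α Tk k p (v k)) {ℓ : Fin 4} (hℓ : ℓ ∈ almostActive r ε i j k p) :
    -α (hTrio r i j k p) ≤ fderiv ℝ (hComp r i j k ℓ) p v := by
  have ej : ({j, k, i} : Finset (Fin n)) = {i, j, k} := by ext; simp; tauto
  have ek : ({k, i, j} : Finset (Fin n)) = {i, j, k} := by ext; simp; tauto
  have h1 := hi j k hTi ℓ hℓ
  have h2 := le_partialDeriv_rotate r ε α hp h (hj k i (ej ▸ hTj)) hℓ
  have h3 := le_partialDeriv_rotate r ε α hp h (fun _ h' =>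
    le_partialDeriv_rotate r ε α hp h.rotate (hk i j (ek ▸ hTk)) h') hℓ
  rw [fderiv_hComp r hp h]
  linarith

/-! ### Nonnegativity of the barrier functions for trios without holes -/

theorem hAgent_nonneg_iff {n : ℕ} {r : ℝ} {T : Finset (Finset (Fin n))} {i : Fin n}
    {p : TeamState n} :
    0 ≤ hAgent r T i p ↔ ∀ j k : Fin n, {i, j, k} ∈ T → 0 ≤ hTrio r i j k p := by
  simp only [hAgent, le_iInf_iff, EReal.coe_nonneg]

/-- A point at which the three side functions of a triangle are positive lies in the triangle:
the side functions are its barycentric coordinates. -/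
theorem mem_convexHull_of_sideFunction_pos {I J K q : Plane}
    (hc : cross (J - I) (K - I) ≠ 0) (h1 : 0 < sideFunction I J K q)
    (h2 : 0 < sideFunction J K I q) (h3 : 0 < sideFunction K I J q) :
    q ∈ convexHull ℝ {I, J, K} := by
  have e2 : cross (K - J) (I - J) = cross (J - I) (K - I) := by
    simp only [cross, PiLp.sub_apply]; ring
  have e3 : cross (I - K) (J - K) = cross (J - I) (K - I) := by
    simp only [cross, PiLp.sub_apply]; ring
  have hsum : sideFunction J K I q + sideFunction K I J q + sideFunction I J K q = 1 := by
    simp only [sideFunction, e2, e3]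
    rw [← add_div, ← add_div, div_eq_one_iff_eq hc]
    simp only [cross, PiLp.sub_apply]
    ring
  have hq : q = sideFunction J K I q • I + sideFunction K I J q • J + sideFunction I J K q • K := by
    have key : ∀ m, cross (J - I) (K - I) * q m = cross (K - J) (q - J) * I m +
        cross (I - K) (q - K) * J m + cross (J - I) (q - I) * K m := by
      intro m
      fin_cases m <;> simp [cross] <;> ring
    ext m
    simp only [sideFunction, e2, e3, PiLp.add_apply, PiLp.smul_apply, smul_eq_mul]
    rw [div_mul_eq_mul_div, div_mul_eq_mul_div, div_mul_eq_mul_div, ← add_div, ← add_div,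
      eq_div_iff hc, ← key m]
    ring
  rw [hq]
  have hconv := convex_convexHull ℝ ({I, J, K} : Set Plane)
  exact hconv.sum_mem (t := Finset.univ)
    (w := ![sideFunction J K I q, sideFunction K I J q, sideFunction I J K q]) (z := ![I, J, K])
    (by intro m _; fin_cases m <;> simp [h1.le, h2.le, h3.le])
    (by simpa [Fin.sum_univ_three] using hsum)
    (by intro m _; fin_cases m <;> exact subset_convexHull ℝ _ (by simp))
    |> (by simpa [Fin.sum_univ_three] using ·)

theorem continuous_sideFunction (I J K : Plane) : Continuous (sideFunction I J K) := by
  unfold sideFunction cross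
  simp only [PiLp.sub_apply]
  fun_prop

/-- If `h_{i,Δ}` is negative, then the radical center, which is the common point of the three power
cells, lies inside the triangle and outside all fields of view, and so does a small disk about
it. -/
theorem exists_isHole {n : ℕ} {r : ℝ} {Q : Set Plane} (hQ : Convex ℝ Q)
    {p : TeamState n} {i j k : Fin n}
    (h : IsNonParallel p i j k) (habove : TrioAbove Q p i j k)
    (hdel : IsDelaunayTriangle r p i j k) (hneg : hTrio r i j k p < 0) :
    ∃ E : Set Plane, IsHole r Q p i j k E := by
  set v := radicalCenter r p i j k with hv
  obtain ⟨w, ⟨hwi, hwj⟩, hwk⟩ := hdel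
  -- A common point of the three power cells has the same power distance to `i`, `j` and `k`.
  have hwv : w = v := (radicalCenter_unique r p i j k h w).2
    ⟨le_antisymm (hwi j) (hwj i), le_antisymm (hwi k) (hwk i)⟩
  subst hwv
  have hℓ : ∀ ℓ, hComp r i j k ℓ p < 0 := fun ℓ =>
    (Finset.le_sup' (fun ℓ => hComp r i j k ℓ p) (Finset.mem_univ ℓ)).trans_lt hneg
  have h0 : 0 < sideFunction (center p i) (center p j) (center p k) v := neg_lt_zero.1 (hℓ 0)
  have h1 : 0 < sideFunction (center p j) (center p k) (center p i) v := neg_lt_zero.1 (hℓ 1)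
  have h2 : 0 < sideFunction (center p k) (center p i) (center p j) v := neg_lt_zero.1 (hℓ 2)
  have h3 : radius r p i ^ 2 - ‖v - center p i‖ ^ 2 < 0 := hℓ 3
  -- As `v` is in the power cell of `i`, no power distance at `v` is smaller than that to `i`, which
  -- is positive by `h3`.
  have hout : ∀ m, radius r p m < ‖v - center p m‖ := fun m => by
    have hm := hwi m
    simp only [powerDist] at hm
    have : radius r p m ^ 2 < ‖v - center p m‖ ^ 2 := by linarith
    exact lt_of_pow_lt_pow_left₀ 2 (norm_nonneg _) this
  set U : Set Plane := {q | 0 < sideFunction (center p i) (center p j) (center p k) q} ∩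
    {q | 0 < sideFunction (center p j) (center p k) (center p i) q} ∩
    {q | 0 < sideFunction (center p k) (center p i) (center p j) q} with hU
  have hUo : IsOpen U := ((isOpen_lt continuous_const (continuous_sideFunction _ _ _)).inter
    (isOpen_lt continuous_const (continuous_sideFunction _ _ _))).inter
    (isOpen_lt continuous_const (continuous_sideFunction _ _ _))
  have hUtri : U ⊆ convexHull ℝ {center p i, center p j, center p k} := fun q hq =>
    mem_convexHull_of_sideFunction_pos h.cross_ne_zero hq.1.1 hq.1.2 hq.2
  have htriQ : convexHull ℝ {center p i, center p j, center p k} ⊆ Q := by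
    refine convexHull_min ?_ hQ
    rintro q (rfl | rfl | rfl)
    exacts [habove.1, habove.2.1, habove.2.2]
  have hnear : ∀ᶠ q in 𝓝 v, q ∈ U ∧ ∀ m, radius r p m < ‖q - center p m‖ := by
    refine Eventually.and (hUo.mem_nhds ⟨⟨h0, h1⟩, h2⟩) (eventually_all.2 fun m => ?_)
    exact ((continuous_id.sub continuous_const).norm.tendsto v).eventually_const_lt (hout m)
  obtain ⟨δ, hδ, hball⟩ := Metric.nhds_basis_closedBall.mem_iff.1 hnear
  refine ⟨Metric.closedBall v δ, Metric.isClosed_closedBall, fun q hq => htriQ (hUtri (hball hq).1),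
    ?_, ?_, ?_, fun q hq => hUtri (hball hq).1⟩
  · exact ⟨v, Metric.ball_subset_interior_closedBall (Metric.mem_ball_self hδ)⟩
  · refine eq_empty_of_forall_notMem fun q hq => ?_
    have hqE : q ∈ Metric.closedBall v δ := Metric.isClosed_closedBall.frontier_subset hq.1
    have hqint : q ∈ interior Q :=
      interior_maximal (hUtri.trans htriQ) hUo (hball hqE).1
    exact hq.2.2 hqint
  · intro m
    refine eq_empty_of_forall_notMem fun q hq => ?_
    exact absurd hq.2 (not_le.2 ((hball (interior_subset hq.1)).2 m))

/-! ### Invariance along trajectories -/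

/-- A velocity of the closed loop at a time `t` satisfies the barrier inequality of a trio that is
in the lists of its three members at that time. -/
theorem neg_le_fderiv_hComp_of_mem_filippov {n : ℕ} {r ε : ℝ} {α : ℝ → ℝ} (hα : Continuous α)
    {u : Fin n → TeamState n → ℝ → AgentState} {p v : TeamState n} {t : ℝ}
    {Tm : Fin n → Finset (Finset (Fin n))} {Dm : Fin n → Set (TeamState n)}
    (hD : ∀ m, IsOpen (Dm m)) (hDreg : ∀ m, Dm m ⊆ regularStates (Tm m) m)
    (hcon : ∀ m, ∀ q ∈ Dm m, LocalConstraint r ε α (Tm m) m q (u m q t))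
    (hp : ∀ m, p ∈ Dm m) (hv : v ∈ filippov (fun q t m => u m q t) p t) {i j k : Fin n}
    (hT : ∀ m ∈ ({i, j, k} : Finset (Fin n)), {i, j, k} ∈ Tm m)
    {ℓ : Fin 4} (hℓ : ℓ ∈ almostActive r ε i j k p) :
    -α (hTrio r i j k p) ≤ fderiv ℝ (hComp r i j k ℓ) p v := by
  have hreg : ∀ q, (∀ m, q ∈ Dm m) → (∀ m, q m 3 ≠ 0) ∧ IsNonParallel q i j k := fun q hq =>
    ⟨fun m => ((hDreg i (hq i)).1 m).2.ne', (hDreg i (hq i)).2 j k (hT i (by simp))⟩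
  obtain ⟨hp3, hpn⟩ := hreg p hp
  have hC := contDiffAt_hComp r hp3 hpn ℓ
  have hH := continuousAt_hTrio r hp3 hpn
  refine le_of_mem_filippov (φ := fderiv ℝ (hComp r i j k ℓ))
    (β := fun q => -α (hTrio r i j k q)) hv (hC.continuousAt_fderiv one_ne_zero)
    (hα.continuousAt.comp hH).neg ?_
  have hact : ∀ᶠ q in 𝓝 p, |hComp r i j k ℓ q - hTrio r i j k q| < ε :=
    ((hC.continuousAt.sub hH).abs).eventually_lt_const hℓ
  filter_upwards [eventually_all.2 fun m => (hD m).mem_nhds (hp m), hact] with q hq hqℓ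
  obtain ⟨hq3, hqn⟩ := hreg q hq
  exact neg_le_fderiv_hComp hq3 hqn (hT i (by simp)) (hT j (by simp)) (hT k (by simp))
    (hcon i q (hq i)) (hcon j q (hq j)) (hcon k q (hq k)) hqℓ

/-- On a switching interval of `i` the safe set is invariant.  The switching instants of the
other quadcopters do not matter, because `T t` contains a trio if and only if it is in the current
list of any one of its members. -/
theorem hAgent_nonneg_of_mem_Ico {n : ℕ} {r t₀ : ℝ}
    {T : ℝ → Finset (Finset (Fin n))} {τ : Fin n → ℕ → ℝ}
    (hτ : ∀ i, IsSwitchingSequence t₀ (τ i))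
    (hT : ∀ i κ, ∀ t ∈ Ico (τ i κ) (τ i (κ + 1)), ∀ Δ : Finset (Fin n), i ∈ Δ →
      (Δ ∈ T t ↔ Δ ∈ T (τ i κ)))
    {D : Fin n → ℕ → Set (TeamState n)} (hD : ∀ i κ, IsOpen (D i κ))
    (hDreg : ∀ i κ, D i κ ⊆ regularStates (T (τ i κ)) i)
    {ε : ℝ} (hε : 0 < ε) {α : ℝ → ℝ} (hα : IsExtendedClassK α)
    {u : Fin n → TeamState n → ℝ → AgentState}
    (hconstraint : ∀ i κ, ∀ t ∈ Ico (τ i κ) (τ i (κ + 1)), ∀ p ∈ D i κ,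
      LocalConstraint r ε α (T (τ i κ)) i p (u i p t))
    {t₁ : ℝ} {x : ℝ → TeamState n} (hx : IsTeamTrajectory r T τ D u t₀ t₁ x) {i : Fin n} {κ : ℕ}
    (h0 : 0 ≤ hAgent r (T (τ i κ)) i (x (τ i κ))) {t : ℝ} (ht : t ∈ Icc t₀ t₁)
    (htκ : t ∈ Ico (τ i κ) (τ i (κ + 1))) : 0 ≤ hAgent r (T (τ i κ)) i (x t) := by
  rw [hAgent_nonneg_iff] at h0 ⊢
  intro j k hΔ
  have hstart : t₀ ≤ τ i κ := (hτ i).start ▸ (hτ i).strictMono.monotone (Nat.zero_le κ)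
  have hsub : Icc (τ i κ) t ⊆ Icc t₀ t₁ := Icc_subset_Icc hstart ht.2
  have hsubκ : ∀ s ∈ Icc (τ i κ) t, s ∈ Ico (τ i κ) (τ i (κ + 1)) := fun s hs =>
    ⟨hs.1, hs.2.trans_lt htκ.2⟩
  refine sup'_nonneg_of_barrier (h := hComp r i j k) (x := x) (α := α) _ htκ.1 hε
    (fun y hy => hα.zero ▸ hα.strictMono.monotone hy) (hx.solution.absolutelyContinuous.mono ?_)
    (fun s hs ℓ => ?_) ?_ (h0 j k hΔ)
  · rwa [uIcc_of_le htκ.1, uIcc_of_le (ht.1.trans ht.2)]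
  · have hreg := hDreg i κ (hx.mem_domain i κ s (hsub hs) (hsubκ s hs))
    exact contDiffAt_hComp r (fun m => (hreg.1 m).2.ne') (hreg.2 j k hΔ) ℓ
  · filter_upwards [hx.solution.inclusion] with s hs hsI
    obtain ⟨v, hv, hder⟩ := hs (hsub hsI)
    refine ⟨v, hder, fun ℓ hℓ => ?_⟩
    choose κ' hκ' using fun m => (hτ m).exists_mem_Ico (hsub hsI).1
    have hΔs : {i, j, k} ∈ T s := (hT i κ s (hsubκ s hsI) _ (by simp)).2 hΔ
    exact neg_le_fderiv_hComp_of_mem_filippov hα.locallyLipschitz.continuous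
      (Tm := fun m => T (τ m (κ' m))) (Dm := fun m => D m (κ' m))
      (fun m => hD m _) (fun m => hDreg m _) (fun m q hq => hconstraint m _ s (hκ' m) q hq)
      (fun m => hx.mem_domain m _ s (hsub hsI) (hκ' m)) hv
      (fun m hm => (hT m _ s (hκ' m) _ hm).1 hΔs) hℓ

end Coverage

theorem theorem4 {n : ℕ} (r : ℝ) (hr : 0 < r) (t₀ : ℝ)
    -- the mission space
    (Q : Set Coverage.Plane) (hQ : IsCompact Q) (hQc : Convex ℝ Q)
    -- the triangular subgraphs at each time, and the switching sequences of the quadcopters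
    (T : ℝ → Finset (Finset (Fin n))) (τ : Fin n → ℕ → ℝ)
    (hτ : ∀ i, Coverage.IsSwitchingSequence t₀ (τ i))
    (hT : ∀ i κ, ∀ t ∈ Set.Ico (τ i κ) (τ i (κ + 1)), ∀ Δ : Finset (Fin n), i ∈ Δ →
      (Δ ∈ T t ↔ Δ ∈ T (τ i κ)))
    -- the domains of the barrier functions
    (D : Fin n → ℕ → Set (Coverage.TeamState n)) (hD : ∀ i κ, IsOpen (D i κ))
    (hDreg : ∀ i κ, D i κ ⊆ Coverage.regularStates (T (τ i κ)) i)
    (ε : ℝ) (hε : 0 < ε) (α : ℝ → ℝ) (hα : Coverage.IsExtendedClassK α)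
    -- the controllers
    (u : Fin n → Coverage.TeamState n → ℝ → Coverage.AgentState)
    (hu : ∀ i, Coverage.IsAdmissibleControl (u i))
    (hconstraint : ∀ i κ, ∀ t ∈ Set.Ico (τ i κ) (τ i (κ + 1)), ∀ p ∈ D i κ,
      Coverage.LocalConstraint r ε α (T (τ i κ)) i p (u i p t))
    (i : Fin n) :
    Coverage.IsHybridForwardInvariant (Coverage.safeSet r T (τ i) i) t₀ (τ i)
        (Coverage.IsTeamTrajectory r T τ D u t₀) ∧
      ∀ (t₁ : ℝ) (x : ℝ → Coverage.TeamState n), t₀ ≤ t₁ →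
        Coverage.IsTeamTrajectory r T τ D u t₀ t₁ x →
        (∀ κ < Coverage.numIntervals (τ i) t₀ t₁,
          ∀ j k : Fin n, {i, j, k} ∈ T (τ i κ) →
            Coverage.TrioAbove Q (x (τ i κ)) i j k ∧
              Coverage.IsDelaunayTriangle r (x (τ i κ)) i j k ∧
              ¬ ∃ E : Set Coverage.Plane, Coverage.IsHole r Q (x (τ i κ)) i j k E) →
        ∀ t ∈ Set.Icc t₀ t₁, (x t, t) ∈ Coverage.safeSet r T (τ i) i := by
  have hinv : ∀ (t₁ : ℝ) (x : ℝ → Coverage.TeamState n), t₀ ≤ t₁ →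
      Coverage.IsTeamTrajectory r T τ D u t₀ t₁ x →
      (∀ κ < Coverage.numIntervals (τ i) t₀ t₁, τ i κ ∈ Icc t₀ t₁ →
        0 ≤ Coverage.hAgent r (T (τ i κ)) i (x (τ i κ))) →
      ∀ t ∈ Set.Icc t₀ t₁, (x t, t) ∈ Coverage.safeSet r T (τ i) i := by
    intro t₁ x _ hx h0 t ht
    obtain ⟨κ, hκ, htκ⟩ := (hτ i).exists_lt_numIntervals ht
    have hstart : t₀ ≤ τ i κ := (hτ i).start ▸ (hτ i).strictMono.monotone (Nat.zero_le κ)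
    exact ⟨κ, htκ, Coverage.hAgent_nonneg_of_mem_Ico hτ hT hD hDreg hε hα hconstraint hx
      (h0 κ hκ ⟨hstart, htκ.1.trans ht.2⟩) ht htκ⟩
  have hself : ∀ κ, τ i κ ∈ Ico (τ i κ) (τ i (κ + 1)) := fun κ =>
    ⟨le_rfl, (hτ i).strictMono (Nat.lt_succ_self κ)⟩
  refine ⟨fun t₁ x h01 hx hC => hinv t₁ x h01 hx fun κ hκ _ => ?_,
    fun t₁ x h01 hx hhole => hinv t₁ x h01 hx fun κ hκ hκI => ?_⟩
  · obtain ⟨κ', hκ', h⟩ := hC κ hκ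
    rwa [← (hτ i).eq_of_mem_Ico (hself κ) hκ'] at h
  · rw [Coverage.hAgent_nonneg_iff]
    intro j k hΔ
    by_contra! hneg
    obtain ⟨habove, hdel, hno⟩ := hhole κ hκ j k hΔ
    have hreg := hDreg i κ (hx.mem_domain i κ _ hκI (hself κ))
    exact hno (Coverage.exists_isHole hQc (hreg.2 j k hΔ) habove hdel hneg)
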